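/- Let $n>m\ge 0$ be integers and let $A,B\subset\mathbb{R}^n$ be disjoint compact sets that are a link pair with nonzero degree, that is: (i) (link pair) there are no continuous maps $H:A\times[0,1]\to\mathbb{R}^n$ and $K:B\times[0,1]\to\mathbb{R}^n$ with $H(x,0)=x$ for $x\in A$, $K(y,0)=y$ for $y\in B$, and $H(A,t)\cap K(B,t)=\emptyset$ for all $t\in[0,1]$, for which there are two disjoint compact balls $D,D'\subset\mathbb{R}^n$ with $H(A,1)\subset D$ and $K(B,1)\subset D'$; (ii) (nonzero degree) the map $$\xi:A\times B\to S^{n-1},\qquad \xi(x,y)=\frac{x-y}{\|x-y\|},$$ has nonzero degree, meaning that it induces a nonzero homomorphism $\tilde H_{n-1}(A\times B;\mathbb{Z})\to\tilde H_{n-1}(S^{n-1};\mathbb{Z})\cong\mathbb{Z}$ on reduced singular homology, where $\tilde H_k(X;\mathbb{Z})$ denotes the kernel of $H_k(X;\mathbb{Z})\to H_k(\mathrm{pt};\mathbb{Z})$. (If $n\ge 2$ and $A\times B$ is a closed connected oriented $(n-1)$-manifold, this says that the degree of $\xi$ is not $0$.) A ReLU network $\mathbb{R}^n\to\mathbb{R}^m$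 is a composition $Net^R=F_k\circ\cdots\circ F_1$, $k\ge 1$, of layer maps $F_i:\mathbb{R}^{n_i}\to\mathbb{R}^{n_{i+1}}$, $F_i(x)=\mathrm{Relu}(W_ix+b_i)$, with $n_1=n$, $n_{k+1}=m$, $W_i\in\mathbb{R}^{n_{i+1}\times n_i}$, $b_i\in\mathbb{R}^{n_{i+1}}$, where $\mathrm{Relu}(x)=\max\{0,x\}$ is applied to each coordinate. Its width is $\max\{n_i: i=1,\dots,k\}$. Then every ReLU network $Net^R:\mathbb{R}^n\to\mathbb{R}^m$ of width at most $n$ fails to classify $A$ and $B$: $$Net^R(A)\cap Net^R(B)\neq\emptyset.$$ -/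

import Mathlib

noncomputable section

open CategoryTheory AlgebraicTopology

/-! ### Linked maps and link pairs -/

/-- Two maps `f : A → ℝⁿ`, `g : B → ℝⁿ` are *unlinked* if there is a homotopy of `f` and a homotopy
of `g` (together: a homotopy defined on the disjoint union of `A` and `B`) whose time-`t` images are
disjoint for every `t ∈ [0,1]` and whose final images lie in two disjoint compact balls. -/
def IsUnlinked {n : ℕ} {A B : Type*} [TopologicalSpace A] [TopologicalSpace B]
    (f : A → EuclideanSpace ℝ (Fin n)) (g : B → EuclideanSpace ℝ (Fin n)) : Prop :=
  ∃ (H : A × unitInterval → EuclideanSpace ℝ (Fin n))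
    (K : B × unitInterval → EuclideanSpace ℝ (Fin n)),
    Continuous H ∧ Continuous K ∧
    (∀ x, H (x, 0) = f x) ∧ (∀ y, K (y, 0) = g y) ∧
    (∀ t x y, H (x, t) ≠ K (y, t)) ∧
    ∃ (c c' : EuclideanSpace ℝ (Fin n)) (r r' : ℝ), 0 < r ∧ 0 < r' ∧
      Disjoint (Metric.closedBall c r) (Metric.closedBall c' r') ∧
      (∀ x, H (x, 1) ∈ Metric.closedBall c r) ∧ (∀ y, K (y, 1) ∈ Metric.closedBall c' r')

/-- Two subsets of `ℝⁿ` are a *link pair* if their inclusions are not unlinked. -/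
def IsLinkPair {n : ℕ} (A B : Set (EuclideanSpace ℝ (Fin n))) : Prop :=
  ¬ IsUnlinked (Subtype.val : A → EuclideanSpace ℝ (Fin n))
      (Subtype.val : B → EuclideanSpace ℝ (Fin n))

/-! ### Degree -/

/-- Singular homology `H_k(X; ℤ)`. -/
abbrev singularH (k : ℕ) (X : Type) [TopologicalSpace X] : ModuleCat.{0} ℤ :=
  ((singularHomologyFunctor (ModuleCat.{0} ℤ) k).obj (ModuleCat.of ℤ ℤ)).obj (TopCat.of X)

/-- The homomorphism `φ_* : H_k(X; ℤ) → H_k(Y; ℤ)` induced by a continuous map `φ`. -/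
abbrev singularHMap (k : ℕ) {X Y : Type} [TopologicalSpace X] [TopologicalSpace Y] (φ : C(X, Y)) :
    singularH k X →ₗ[ℤ] singularH k Y :=
  (((singularHomologyFunctor (ModuleCat.{0} ℤ) k).obj (ModuleCat.of ℤ ℤ)).map
    (TopCat.ofHom φ)).hom

/-- The unit sphere `Sⁿ⁻¹ ⊆ ℝⁿ`. -/
abbrev unitSphere (n : ℕ) : Type := Metric.sphere (0 : EuclideanSpace ℝ (Fin n)) 1

/-- A continuous map `ξ : X → Sⁿ⁻¹` has *nonzero degree* if it induces a nonzero homomorphism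
`H̃_{n-1}(X; ℤ) → H̃_{n-1}(Sⁿ⁻¹; ℤ) ≅ ℤ` on reduced integral singular homology. Here `H̃_k(X; ℤ)` is
the kernel of the map `H_k(X; ℤ) → H_k(point; ℤ)`, so it is all of `H_k(X; ℤ)` for `k ≥ 1`.
If `X` is a closed connected oriented `(n-1)`-manifold, `n ≥ 2`, then `H_{n-1}(X; ℤ) ≅ ℤ`, the
induced homomorphism is multiplication by the degree of `ξ`, and the condition says exactly that
this degree is not `0`. -/
def HasNonzeroDegree {n : ℕ} {X : Type} [TopologicalSpace X] (ξ : C(X, unitSphere n)) : Prop :=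
  ∃ c : singularH (n - 1) X,
    singularHMap (n - 1) (ContinuousMap.const X (() : Unit)) c = 0 ∧ singularHMap (n - 1) ξ c ≠ 0

/-- For disjoint `A, B ⊆ ℝⁿ`, the map `ξ : A × B → Sⁿ⁻¹`, `ξ(x, y) = (x - y) / ‖x - y‖`. -/
def linkMap {n : ℕ} {A B : Set (EuclideanSpace ℝ (Fin n))} (hAB : Disjoint A B) :
    C(A × B, unitSphere n) where
  toFun p := ⟨‖(p.1 : EuclideanSpace ℝ (Fin n)) - p.2‖⁻¹ •
      ((p.1 : EuclideanSpace ℝ (Fin n)) - p.2), by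
    have h : (p.1 : EuclideanSpace ℝ (Fin n)) - p.2 ≠ 0 :=
      sub_ne_zero.2 (hAB.ne_of_mem p.1.2 p.2.2)
    rw [mem_sphere_zero_iff_norm, norm_smul, norm_inv, norm_norm,
      inv_mul_cancel₀ (norm_ne_zero_iff.2 h)]⟩
  continuous_toFun := by
    have hc : Continuous fun p : A × B => (p.1 : EuclideanSpace ℝ (Fin n)) - p.2 := by fun_prop
    exact ((hc.norm.inv₀ fun p => norm_ne_zero_iff.2
      (sub_ne_zero.2 (hAB.ne_of_mem p.1.2 p.2.2))).smul hc).subtype_mk _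

/-! ### ReLU networks -/

/-- The coordinatewise rectified linear unit `ℝⁿ → ℝⁿ`. -/
def relu {n : ℕ} (x : EuclideanSpace ℝ (Fin n)) : EuclideanSpace ℝ (Fin n) :=
  WithLp.toLp 2 fun i => max 0 (x i)

/-- The layer map `x ↦ ReLU (W x + b)`. -/
def reluLayer {n m : ℕ} (W : Matrix (Fin m) (Fin n) ℝ) (b : EuclideanSpace ℝ (Fin m))
    (x : EuclideanSpace ℝ (Fin n)) : EuclideanSpace ℝ (Fin m) :=
  relu (Matrix.toEuclideanLin W x + b)

/-- The parameters of a network `F_k ∘ ⋯ ∘ F_1`, `k ≥ 1`, with layer maps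
`F_i : ℝ^{n_i} → ℝ^{n_{i+1}}`, `F_i x = ReLU (W_i x + b_i)`, from input dimension `n = n_1` to output
dimension `m = n_{k+1}`. The constructor `cons W b N` puts the layer `(W, b)` in front of `N`. -/
inductive ReLUNet : ℕ → ℕ → Type
  | single {n m : ℕ} (W : Matrix (Fin m) (Fin n) ℝ) (b : EuclideanSpace ℝ (Fin m)) : ReLUNet n m
  | cons {n p m : ℕ} (W : Matrix (Fin p) (Fin n) ℝ) (b : EuclideanSpace ℝ (Fin p))
      (N : ReLUNet p m) : ReLUNet n m

/-- The map `ℝⁿ → ℝᵐ` computed by a network. -/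
def ReLUNet.eval {n m : ℕ} : ReLUNet n m → EuclideanSpace ℝ (Fin n) → EuclideanSpace ℝ (Fin m)
  | .single W b => reluLayer W b
  | .cons W b N => fun x => N.eval (reluLayer W b x)

/-- The width `max {n_1, …, n_k}` of a network with `k` layers `F_i : ℝ^{n_i} → ℝ^{n_{i+1}}`. -/
def ReLUNet.width {n m : ℕ} : ReLUNet n m → ℕ
  | .single _ _ => n
  | .cons _ _ N => max n N.width

end

/-! If a network separates `A` and `B`, then `x - y`, as a map from `A × B` to the punctured space,
is nullhomotopic; hence so is its radial projection `linkMap`, which then vanishes on reduced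
homology. The nullhomotopy comes from induction on layers (`ReLUNet.diffMap_nullhomotopic`). A
non-injective weight matrix has a kernel vector `v ≠ 0`, and `x - y` deforms straight to `v`. An
injective one is square by the width bound, and monotonicity of ReLU gives a straight deformation
from `W (x - y)` to the difference of the layer outputs, to which induction applies. The output
dimension `m < n` forces a non-injective layer. -/

/-- Homotopic maps induce the same homomorphism on singular homology. -/
theorem singularHMap_eq_of_homotopic (k : ℕ) {X Y : Type} [TopologicalSpace X]
    [TopologicalSpace Y] {φ ψ : C(X, Y)} (h : φ.Homotopic ψ) :
    singularHMap k φ = singularHMap k ψ := by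
  obtain ⟨H⟩ := h
  have H' : TopCat.Homotopy (TopCat.ofHom φ) (TopCat.ofHom ψ) := H
  exact congrArg ModuleCat.Hom.hom
    (H'.congr_homologyMap_singularChainComplexFunctor (ModuleCat.of ℤ ℤ) k)

theorem singularHMap_comp_apply (k : ℕ) {X Y Z : Type} [TopologicalSpace X]
    [TopologicalSpace Y] [TopologicalSpace Z] (ψ : C(Y, Z)) (φ : C(X, Y)) (c : singularH k X) :
    singularHMap k (ψ.comp φ) c = singularHMap k ψ (singularHMap k φ c) := by
  simp [singularHMap, TopCat.ofHom_comp]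

/-- A map of nonzero degree is not nullhomotopic. -/
theorem HasNonzeroDegree.not_nullhomotopic {n : ℕ} {X : Type} [TopologicalSpace X]
    {ξ : C(X, unitSphere n)} (h : HasNonzeroDegree ξ) : ¬ ξ.Nullhomotopic := by
  rintro ⟨y, hy⟩
  obtain ⟨c, hc, hne⟩ := h
  apply hne
  have hcomp : ContinuousMap.const X y =
      (ContinuousMap.const Unit y).comp (ContinuousMap.const X ()) := rfl
  -- A constant map factors through a point, where the reduced class `c` already dies.
  rw [singularHMap_eq_of_homotopic _ hy, hcomp, singularHMap_comp_apply, hc, map_zero]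

/-- The difference of two maps that differ at every point, as a map to the punctured space. -/
def diffMap {Z E : Type*} [TopologicalSpace Z] [NormedAddCommGroup E] (f g : C(Z, E))
    (h : ∀ z, f z ≠ g z) : C(Z, {x : E // x ≠ 0}) where
  toFun z := ⟨f z - g z, sub_ne_zero.2 (h z)⟩
  continuous_toFun := by fun_prop

/-- Two maps to the punctured space are homotopic if the segments joining their values avoid `0`. -/
theorem homotopic_of_segment_ne_zero {Z E : Type*} [TopologicalSpace Z] [NormedAddCommGroup E]
    [NormedSpace ℝ E] (u v : C(Z, {x : E // x ≠ 0}))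
    (h : ∀ t : ℝ, 0 ≤ t → t ≤ 1 → ∀ z, (1 - t) • (u z : E) + t • (v z : E) ≠ 0) :
    u.Homotopic v :=
  ⟨{ toFun := fun p => ⟨(1 - (p.1 : ℝ)) • (u p.2 : E) + (p.1 : ℝ) • (v p.2 : E),
        h p.1 p.1.2.1 p.1.2.2 p.2⟩
     continuous_toFun := by fun_prop
     map_zero_left := fun z => by simp
     map_one_left := fun z => by simp }⟩

/-- If a linear map with a nonzero kernel vector separates `f` and `g` pointwise, then `f - g` is
nullhomotopic in the punctured space. -/
theorem diffMap_nullhomotopic_of_not_injective {Z E F : Type*} [TopologicalSpace Z]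
    [NormedAddCommGroup E] [NormedSpace ℝ E] [AddCommGroup F] [Module ℝ F] (L : E →ₗ[ℝ] F)
    (hL : ¬ Function.Injective L) (f g : C(Z, E)) (h : ∀ z, f z ≠ g z)
    (hs : ∀ z, L (f z) ≠ L (g z)) : (diffMap f g h).Nullhomotopic := by
  rw [injective_iff_map_eq_zero] at hL
  push Not at hL
  obtain ⟨v, hv, hv0⟩ := hL
  -- Along the segment to `v`, `L` takes the value `(1 - t) • (L (f z) - L (g z))`, which vanishes
  -- only at `t = 1`, where the segment has reached `v ≠ 0`.
  refine ⟨⟨v, hv0⟩, homotopic_of_segment_ne_zero _ _ fun t _ _ z hz => ?_⟩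
  simp only [diffMap, ContinuousMap.coe_mk, ContinuousMap.const_apply] at hz
  have hz' := congrArg L hz
  simp only [map_add, map_smul, map_sub, hv, smul_zero, add_zero, map_zero] at hz'
  rcases smul_eq_zero.1 hz' with ht | ht
  · obtain rfl : t = 1 := by linarith
    simp [hv0] at hz
  · exact hs z (sub_eq_zero.1 ht)

theorem continuous_relu {n : ℕ} : Continuous (relu (n := n)) := by
  unfold relu
  fun_prop

theorem continuous_reluLayer {n m : ℕ} (W : Matrix (Fin m) (Fin n) ℝ)
    (b : EuclideanSpace ℝ (Fin m)) : Continuous (reluLayer W b) :=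
  continuous_relu.comp
    ((LinearMap.continuous_of_finiteDimensional (Matrix.toEuclideanLin W)).add continuous_const)

theorem reluLayer_ne_imp {n m : ℕ} {W : Matrix (Fin m) (Fin n) ℝ}
    {b : EuclideanSpace ℝ (Fin m)} {x y : EuclideanSpace ℝ (Fin n)}
    (h : reluLayer W b x ≠ reluLayer W b y) :
    Matrix.toEuclideanLin W x ≠ Matrix.toEuclideanLin W y := fun e => h (by simp [reluLayer, e])

/-- Since `max 0` is monotone, both differences are negative, so no convex combination of them
cancels. -/
theorem convexComb_max_neg {p q t : ℝ} (h0 : 0 ≤ t) (h1 : t ≤ 1) (h : max 0 p < max 0 q) :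
    (1 - t) * (p - q) + t * (max 0 p - max 0 q) < 0 := by
  have hpq : p < q := by
    by_contra! hqp
    exact absurd h (not_lt.2 (max_le_max le_rfl hqp))
  rcases h1.lt_or_eq with ht | rfl
  · nlinarith [mul_pos (sub_pos.2 ht) (sub_pos.2 hpq), mul_nonneg h0 (sub_pos.2 h).le]
  · linarith

/-- The straight-line homotopy from the identity to `relu` does not identify points that `relu`
separates. -/
theorem relu_eq_of_convexComb_eq_zero {n : ℕ} {x y : EuclideanSpace ℝ (Fin n)} {t : ℝ}
    (h0 : 0 ≤ t) (h1 : t ≤ 1) (h : (1 - t) • (x - y) + t • (relu x - relu y) = 0) :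
    relu x = relu y := by
  ext i
  have hi : (1 - t) * (x i - y i) + t * (max 0 (x i) - max 0 (y i)) = 0 := by
    simpa [relu] using congrArg (fun v : EuclideanSpace ℝ (Fin n) => v i) h
  change max 0 (x i) = max 0 (y i)
  rcases lt_trichotomy (max 0 (x i)) (max 0 (y i)) with hlt | heq | hgt
  · exact absurd hi (convexComb_max_neg h0 h1 hlt).ne
  · exact heq
  · have := convexComb_max_neg h0 h1 hgt
    linarith

/-- Nullhomotopy of a difference can be pulled back along an injective layer. -/
theorem diffMap_nullhomotopic_of_reluLayer {n : ℕ} {Z : Type*} [TopologicalSpace Z]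
    (W : Matrix (Fin n) (Fin n) ℝ) (b : EuclideanSpace ℝ (Fin n))
    (hW : Function.Injective (Matrix.toEuclideanLin W))
    (f g f' g' : C(Z, EuclideanSpace ℝ (Fin n))) (h : ∀ z, f z ≠ g z)
    (h' : ∀ z, f' z ≠ g' z) (hf : ∀ z, f' z = reluLayer W b (f z))
    (hg : ∀ z, g' z = reluLayer W b (g z)) (hnull : (diffMap f' g' h').Nullhomotopic) :
    (diffMap f g h).Nullhomotopic := by
  let e := LinearEquiv.ofInjectiveEndo (Matrix.toEuclideanLin W) hW
  have he : ∀ x, e x = Matrix.toEuclideanLin W x := fun _ => rfl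
  have hec : Continuous e := LinearMap.continuous_of_finiteDimensional e.toLinearMap
  have hesc : Continuous e.symm := LinearMap.continuous_of_finiteDimensional e.symm.toLinearMap
  let eN : C({x : EuclideanSpace ℝ (Fin n) // x ≠ 0}, {x : EuclideanSpace ℝ (Fin n) // x ≠ 0}) :=
    ⟨fun x => ⟨e x, e.map_ne_zero_iff.2 x.2⟩, by fun_prop⟩
  let eI : C({x : EuclideanSpace ℝ (Fin n) // x ≠ 0}, {x : EuclideanSpace ℝ (Fin n) // x ≠ 0}) :=
    ⟨fun x => ⟨e.symm x, e.symm.map_ne_zero_iff.2 x.2⟩, by fun_prop⟩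
  -- The bias cancels in the difference, so only ReLU has to be deformed away.
  have hhom : (eN.comp (diffMap f g h)).Homotopic (diffMap f' g' h') := by
    refine homotopic_of_segment_ne_zero _ _ fun t h0 h1 z hz => h' z ?_
    rw [hf, hg]
    refine relu_eq_of_convexComb_eq_zero h0 h1 ?_
    rw [← hz]
    simp only [eN, diffMap, ContinuousMap.comp_apply, ContinuousMap.coe_mk, hf, hg, he, map_sub,
      reluLayer, add_sub_add_right_eq_sub]
  obtain ⟨y, hy⟩ := hnull
  have hN : (eN.comp (diffMap f g h)).Nullhomotopic := ⟨y, hhom.trans hy⟩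
  have hI : eI.comp (eN.comp (diffMap f g h)) = diffMap f g h := by
    ext1 z
    exact Subtype.ext (e.symm_apply_apply _)
  exact hI ▸ hN.comp_right eI

theorem not_injective_toEuclideanLin {n m : ℕ} (W : Matrix (Fin m) (Fin n) ℝ) (h : m < n) :
    ¬ Function.Injective (Matrix.toEuclideanLin W) := fun hi => by
  have := LinearMap.finrank_le_finrank_of_injective hi
  simp only [finrank_euclideanSpace, Fintype.card_fin] at this
  omega

theorem ReLUNet.input_le_width {n m : ℕ} (N : ReLUNet n m) : n ≤ N.width := by
  cases N with
  | single => exact le_rfl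
  | cons => exact le_max_left _ _

/-- If a network of width at most `n` and output dimension less than `n` separates `f` and `g`
pointwise, then `f - g` is nullhomotopic in the punctured space. -/
theorem ReLUNet.diffMap_nullhomotopic {n m : ℕ} (N : ReLUNet n m) (hmn : m < n)
    (hN : N.width ≤ n) {Z : Type*} [TopologicalSpace Z] (f g : C(Z, EuclideanSpace ℝ (Fin n)))
    (h : ∀ z, f z ≠ g z) (hs : ∀ z, N.eval (f z) ≠ N.eval (g z)) :
    (diffMap f g h).Nullhomotopic := by
  induction N with
  | single W b =>
    exact diffMap_nullhomotopic_of_not_injective _ (not_injective_toEuclideanLin W hmn) f g h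
      fun z => reluLayer_ne_imp (hs z)
  | @cons n p m W b N ih =>
    have hlayer : ∀ z, reluLayer W b (f z) ≠ reluLayer W b (g z) := fun z e =>
      hs z (congrArg N.eval e)
    by_cases hW : Function.Injective (Matrix.toEuclideanLin W)
    · have hNn : N.width ≤ n := (le_max_right _ _).trans hN
      -- Width gives `p ≤ n`, injectivity gives `n ≤ p`.
      obtain rfl : p = n := le_antisymm (N.input_le_width.trans hNn)
        (not_lt.1 fun hp => not_injective_toEuclideanLin W hp hW)
      let F : C(EuclideanSpace ℝ (Fin p), EuclideanSpace ℝ (Fin p)) :=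
        ⟨reluLayer W b, continuous_reluLayer W b⟩
      exact diffMap_nullhomotopic_of_reluLayer W b hW f g (F.comp f) (F.comp g) h hlayer
        (fun _ => rfl) (fun _ => rfl) (ih hmn hNn (F.comp f) (F.comp g) hlayer hs)
    · exact diffMap_nullhomotopic_of_not_injective _ hW f g h fun z => reluLayer_ne_imp (hlayer z)

/-- Radial projection of the punctured space to the unit sphere. -/
noncomputable def radialProjection (n : ℕ) :
    C({x : EuclideanSpace ℝ (Fin n) // x ≠ 0}, unitSphere n) where
  toFun x := ⟨‖(x : EuclideanSpace ℝ (Fin n))‖⁻¹ • (x : EuclideanSpace ℝ (Fin n)), by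
    rw [mem_sphere_zero_iff_norm, norm_smul, norm_inv, norm_norm,
      inv_mul_cancel₀ (norm_ne_zero_iff.2 x.2)]⟩
  continuous_toFun :=
    ((continuous_subtype_val.norm.inv₀ fun x => norm_ne_zero_iff.2 x.2).smul
      continuous_subtype_val).subtype_mk _

theorem proposition5p2 {n m : ℕ} (hmn : m < n)
    (A B : Set (EuclideanSpace ℝ (Fin n))) (hA : IsCompact A) (hB : IsCompact B)
    (hAB : Disjoint A B) (hlink : IsLinkPair A B) (hdeg : HasNonzeroDegree (linkMap hAB))
    (N : ReLUNet n m) (hN : N.width ≤ n) :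
    (N.eval '' A ∩ N.eval '' B).Nonempty := by
  by_contra hempty
  have hs : ∀ z : A × B, N.eval z.1 ≠ N.eval z.2 := fun z e =>
    hempty ⟨N.eval z.1, ⟨_, z.1.2, rfl⟩, ⟨_, z.2.2, e.symm⟩⟩
  have hnull := N.diffMap_nullhomotopic hmn hN
    (⟨fun z => z.1, by fun_prop⟩ : C(A × B, EuclideanSpace ℝ (Fin n)))
    (⟨fun z => z.2, by fun_prop⟩ : C(A × B, EuclideanSpace ℝ (Fin n)))
    (fun z => hAB.ne_of_mem z.1.2 z.2.2) hs
  -- `linkMap hAB` is by definition the radial projection of `x - y`.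
  exact hdeg.not_nullhomotopic (hnull.comp_right (radialProjection n))
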